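/- All graphs $G=(V_G,E_G)$ are finite, undirected, simple and connected (with at least one vertex). $N_G(v)$ is the set of neighbours of $v$, $\{\!\{\cdot\}\!\}$ denotes multisets, and $\mathsf{hash}$ is a perfect (injective) hash function. Let $\operatorname{dis}_G(u,v)$ be the shortest-path distance, and let the hitting time distance $\operatorname{dis}^{\mathsf H}_G(u,v)$ be the expected number of steps that the simple random walk on $G$ started at $u$ makes until it visits $v$ for the first time (so $\operatorname{dis}^{\mathsf H}_G(u,u)=0$). Put $d_G(u,v)=(\operatorname{dis}_G(u,v),\operatorname{dis}^{\mathsf H}_G(u,v))$. $\mathsf{GD\text{-}WL}$ is the colour refinement algorithm on vertices with constant initial colour and $$\chi_G^{(t+1)}(v)=\mathsf{hash}\big(\{\!\{(d_G(u,v),\chi_G^{(t)}(u)):u\in V_G\}\!\}\big),$$ and with graph representation $c(G)=\mathsf{hash}(\{\!\{\chi_G(v):v\in V_G\}\!\})$. $\mathsf{PSWL(VS)}$ is the colour refinement algorithm on pairs of vertices whose initial colour $\chi_G^{(0)}(u,v)$ records whether $u=v$ (node marking), with $$\chi_G^{(t+1)}(u,v)=\mathsf{hash}\big(\chi_G^{(t)}(u,v),\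 \chi_G^{(t)}(v,v),\ \{\!\{\chi_G^{(t)}(u,w):w\in N_G(v)\}\!\}\big),$$ and with graph representation $c(G)=\mathsf{hash}(\{\!\{\mathsf{hash}(\{\!\{\chi_G(u,v):v\in V_G\}\!\}):u\in V_G\}\!\})$. In both cases $\chi_G$ is the stable colouring. Two graphs are compared after the same, sufficiently large, number of iterations; that is, $c(G)=c(H)$ means that the representations computed from $\chi^{(t)}$ agree for all sufficiently large $t$. **Theorem.** $\mathsf{GD\text{-}WL}\prec\mathsf{PSWL(VS)}$, i.e. $\mathsf{GD\text{-}WL}$ is strictly weaker than $\mathsf{PSWL(VS)}$: 1. for all graphs $G,H$, if $\mathsf{PSWL(VS)}$ gives $c(G)=c(H)$, then $\mathsf{GD\text{-}WL}$ gives $c(G)=c(H)$; 2. there are graphs $G,H$ with $c(G)\ne c(H)$ for $\mathsf{PSWL(VS)}$ but $c(G)=c(H)$ for $\mathsf{GD\text{-}WL}$. -/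

import Mathlib

open scoped ENNReal

/-- Finite, undirected, simple, connected graphs. (Connectedness includes that there is at least
one vertex; the decidability fields carry no mathematical content.) -/
structure FinConnGraph where
  V : Type
  [fintypeV : Fintype V]
  [decEqV : DecidableEq V]
  graph : SimpleGraph V
  [decAdj : DecidableRel graph.Adj]
  connected : graph.Connected

attribute [instance] FinConnGraph.fintypeV FinConnGraph.decEqV FinConnGraph.decAdj

namespace FinConnGraph

/-- Shortest-path distance. -/
noncomputable def spd (G : FinConnGraph) (u v : G.V) : ℕ := G.graph.dist u v

/-- The probability that the first `d` steps of the simple random walk on `G` started at `p 0`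
(each step goes to a uniformly random neighbour) are `p 0, p 1, …, p d`. -/
noncomputable def walkProb (G : FinConnGraph) {d : ℕ} (p : Fin (d + 1) → G.V) : ℝ≥0∞ :=
  ∏ i : Fin d,
    if G.graph.Adj (p i.castSucc) (p i.succ)
    then ((G.graph.degree (p i.castSucc) : ℝ≥0∞))⁻¹ else 0

/-- The probability that the simple random walk started at `u` visits `v` for the first time after
exactly `d` steps: the total probability of the walks `(x₀, …, x_d)` with `x₀ = u`, `x_d = v` and
`x_i ≠ v` for all `i < d`. -/
noncomputable def firstHitProb (G : FinConnGraph) (u v : G.V) (d : ℕ) : ℝ≥0∞ :=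
  ∑ p : Fin (d + 1) → G.V with
      p 0 = u ∧ p (Fin.last d) = v ∧ ∀ i : Fin d, p i.castSucc ≠ v,
    G.walkProb p

/-- Hitting time distance: the expected number of steps of the simple random walk started at `u`
until it reaches `v` for the first time. (The walk on a finite connected graph reaches `v` almost
surely, so that this sum is the full expectation; it is `0` for `u = v`. The values are extended
nonnegative reals, so that no question of summability arises.) -/
noncomputable def hittingTime (G : FinConnGraph) (u v : G.V) : ℝ≥0∞ :=
  ∑' d : ℕ, (d : ℝ≥0∞) * G.firstHitProb u v d

end FinConnGraph

/-- A colour refinement algorithm: for every number `t` of iterations it assigns to every graph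
a representation. -/
structure ColourRefinement where
  Rep : ℕ → Type
  rep : (t : ℕ) → FinConnGraph → Rep t

namespace ColourRefinement

/-- `c(G) = c(H)`: the two graphs get the same representation from stable colours, i.e. from the
colours after any sufficiently large number of iterations, run in parallel on both graphs.
(Every iteration refines the colours, so representations that differ once differ ever after; hence
the negation says that they differ after any sufficiently large number of iterations.) -/
def Same (A : ColourRefinement) (G H : FinConnGraph) : Prop :=
  ∀ᶠ t in Filter.atTop, A.rep t G = A.rep t H

/-- `A₂ ⪯ A₁`, i.e. `A₁` is more powerful than `A₂`. -/
def AtMostAsPowerful (A₂ A₁ : ColourRefinement) : Prop :=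
  ∀ G H : FinConnGraph, A₁.Same G H → A₂.Same G H

/-- `A₂ ≃ A₁`. -/
def Equivalent (A₂ A₁ : ColourRefinement) : Prop := AtMostAsPowerful A₂ A₁ ∧ AtMostAsPowerful A₁ A₂

/-- `A₂ ≺ A₁`, i.e. `A₁` is strictly more powerful than `A₂`. -/
def StrictlyWeaker (A₂ A₁ : ColourRefinement) : Prop := AtMostAsPowerful A₂ A₁ ∧ ¬ Equivalent A₂ A₁

end ColourRefinement

/-! Colours. A perfect hash function is an injective relabelling, so the argument of the hash
function itself is used as the new colour. -/

/-- The values of the generalized distance `(dis, dis^H)`. -/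
abbrev GenDist : Type := ℕ × ℝ≥0∞

/-- `d_G(u,v) = (dis_G(u,v), dis^H_G(u,v))`. -/
noncomputable def genDist (G : FinConnGraph) (u v : G.V) : GenDist :=
  (G.spd u v, G.hittingTime u v)

/-- Node colours of GD-WL after `t` iterations. -/
def GDColour : ℕ → Type
  | 0 => Unit
  | t + 1 => Multiset (GenDist × GDColour t)

/-- The GD-WL colour of a node after `t` iterations: constant at first, then
`χ⁽ᵗ⁺¹⁾(v) = hash {{ (d_G(u,v), χ⁽ᵗ⁾(u)) : u ∈ V }}`. -/
noncomputable def gdColour (G : FinConnGraph) : (t : ℕ) → G.V → GDColour t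
  | 0, _ => ()
  | t + 1, v => (Finset.univ : Finset G.V).val.map fun u => (genDist G u v, gdColour G t u)

/-- GD-WL with the generalized distance `(dis, dis^H)`; the graph representation is the multiset
of the node colours. -/
noncomputable def GDWL : ColourRefinement where
  Rep t := Multiset (GDColour t)
  rep t G := (Finset.univ : Finset G.V).val.map fun v => gdColour G t v

/-- Colours of node pairs of PSWL after `t` iterations. -/
def PSWLColour : ℕ → Type
  | 0 => Bool
  | t + 1 => PSWLColour t × PSWLColour t × Multiset (PSWLColour t)

/-- The PSWL colour of the pair `(u, v)` after `t` iterations: node marking (is `u = v`?) at first,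
then `χ⁽ᵗ⁺¹⁾(u,v) = hash (χ⁽ᵗ⁾(u,v), χ⁽ᵗ⁾(v,v), {{ χ⁽ᵗ⁾(u,w) : w ∈ N_G(v) }})`. -/
def pswlColour (G : FinConnGraph) : (t : ℕ) → G.V → G.V → PSWLColour t
  | 0, u, v => decide (u = v)
  | t + 1, u, v =>
    (pswlColour G t u v, pswlColour G t v v,
      (G.graph.neighborFinset v).val.map fun w => pswlColour G t u w)

/-- PSWL(VS), with vertex-subgraph pooling `{{ {{ χ(u,v) : v ∈ V }} : u ∈ V }}`. -/
def PSWLVS : ColourRefinement where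
  Rep t := Multiset (Multiset (PSWLColour t))
  rep t G := (Finset.univ : Finset G.V).val.map fun u =>
    (Finset.univ : Finset G.V).val.map fun v => pswlColour G t u v

/-! With `u` fixed, the stable PSWL colours of the pairs `(u, v)` form an equitable colouring in
which the mark isolates `u`. They determine whatever is computed from `u` by recursion over
neighbourhoods: the distance from `v` to `u` and, conditioning on the first step, the law of the
first visit to `u` from `v`. By connectedness and double counting of edges between classes, the
colour of `(u, u)` fixes all class sizes (`map_univ_pairColour_eq`). As the colour of `(u, v)` also
determines that of `(v, v)`, induction on rounds recovers the GD-WL colours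
(`gdColour_eq_of_pairColour_eq`).

For strictness, let F be the edge set of a 2-regular graph on six points, and attach pendant
vertices to the members of F in the Kneser graph of all pairs. A member of F is disjoint from three
members of F, any other pair from two, whatever F is. Distances and hitting times depend only on the
types of the vertices and on whether their feet are equal, disjoint or meeting, so GD-WL sees
nothing but types (`view_hexagon`). PSWL detects triangles of vertices of degree 7, that is, perfect
matchings inside F: a hexagon has one, two triangles have none. -/

/-- Equality of images of multisets passes to coarser functions. -/
theorem Multiset.map_eq_map_of_imp {α β γ δ : Type*} {f : α → γ} {g : β → γ} {f' : α → δ}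
    {g' : β → δ} {s : Multiset α} {t : Multiset β} (h : s.map f = t.map g)
    (H : ∀ a ∈ s, ∀ b ∈ t, f a = g b → f' a = g' b) : s.map f' = t.map g' := by
  rw [← Multiset.rel_eq, Multiset.rel_map] at h ⊢
  exact h.mono H

/-! ### Stable PSWL colours and what they determine -/

namespace FinConnGraph

variable {G H : FinConnGraph}

theorem pswlColour_eq_of_le {s t : ℕ} (hst : s ≤ t) {u v : G.V} {u' v' : H.V}
    (h : pswlColour G t u v = pswlColour H t u' v') :
    pswlColour G s u v = pswlColour H s u' v' := by
  induction t, hst using Nat.le_induction with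
  | base => exact h
  | succ t _ ih => exact ih (Prod.mk.inj h).1

/-- The sequence of all PSWL colours of a pair of vertices. -/
def pairColour (G : FinConnGraph) (u v : G.V) : (t : ℕ) → PSWLColour t :=
  fun t => pswlColour G t u v

-- Colours that differ at one stage differ at all later ones, and there are only finitely many
-- pairs, so a single stage separates all that is ever separated.
variable (G H) in
theorem eventually_pairColour_eq : ∀ᶠ t in Filter.atTop, ∀ (u v : G.V) (u' v' : H.V),
    pswlColour G t u v = pswlColour H t u' v' → G.pairColour u v = H.pairColour u' v' := by
  simp only [Filter.eventually_all]
  intro u v u' v'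
  by_cases h : G.pairColour u v = H.pairColour u' v'
  · exact Filter.Eventually.of_forall fun _ _ => h
  · obtain ⟨s, hs⟩ := Function.ne_iff.1 h
    filter_upwards [Filter.eventually_ge_atTop s] with t ht h'
    exact absurd (pswlColour_eq_of_le ht h') hs

section

variable {u v : G.V} {u' v' : H.V}

theorem eq_iff_of_pairColour_eq (h : G.pairColour u v = H.pairColour u' v') :
    u = v ↔ u' = v' :=
  decide_eq_decide.1 (congrFun h 0)

theorem pairColour_diag_eq (h : G.pairColour u v = H.pairColour u' v') :
    G.pairColour v v = H.pairColour v' v' :=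
  funext fun t => (Prod.mk.inj (Prod.mk.inj (congrFun h (t + 1))).2).1

theorem map_neighborFinset_pairColour_eq (h : G.pairColour u v = H.pairColour u' v') :
    (G.graph.neighborFinset v).val.map (G.pairColour u) =
      (H.graph.neighborFinset v').val.map (H.pairColour u') := by
  obtain ⟨t, ht⟩ := (eventually_pairColour_eq G H).exists
  exact Multiset.map_eq_map_of_imp (Prod.mk.inj (Prod.mk.inj (congrFun h (t + 1))).2).2
    fun w _ w' _ hw => ht u w u' w' hw

theorem degree_eq_of_pairColour_eq (h : G.pairColour u v = H.pairColour u' v') :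
    G.graph.degree v = H.graph.degree v' := by
  simpa using congrArg Multiset.card (map_neighborFinset_pairColour_eq h)

theorem exists_adj_pairColour_eq (h : G.pairColour u v = H.pairColour u' v') {w : G.V}
    (hw : G.graph.Adj v w) : ∃ w', H.graph.Adj v' w' ∧ H.pairColour u' w' = G.pairColour u w := by
  have : G.pairColour u w ∈ (H.graph.neighborFinset v').val.map (H.pairColour u') := by
    rw [← map_neighborFinset_pairColour_eq h]
    exact Multiset.mem_map_of_mem _ ((G.graph.mem_neighborFinset v w).2 hw)
  obtain ⟨w', hw', e⟩ := Multiset.mem_map.1 this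
  exact ⟨w', (H.graph.mem_neighborFinset v' w').1 hw', e⟩

end

/-- Double counting of the edges between two colour classes of an equitable colouring. -/
theorem count_mul_eq_count_mul {C : Type*} [DecidableEq C] (f : G.V → C) {a b : C} {p q : ℕ}
    (hp : ∀ v, f v = a → ((G.graph.neighborFinset v).val.map f).count b = p)
    (hq : ∀ v, f v = b → ((G.graph.neighborFinset v).val.map f).count a = q) :
    ((Finset.univ : Finset G.V).val.map f).count a * p =
      ((Finset.univ : Finset G.V).val.map f).count b * q := by
  have key (s : Finset G.V) (c : C) : (s.val.map f).count c = (s.filter fun w => f w = c).card := by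
    rw [Multiset.count_map]
    simp only [eq_comm (a := c)]
    rfl
  simp only [key] at hp hq ⊢
  refine Finset.card_mul_eq_card_mul G.graph.Adj (fun v hv => ?_) fun v hv => ?_
  · rw [← hp v (Finset.mem_filter.1 hv).2]
    congr 1
    ext w
    simp [Finset.mem_bipartiteAbove, and_comm]
  · rw [← hq v (Finset.mem_filter.1 hv).2]
    congr 1
    ext w
    simp [Finset.mem_bipartiteBelow, and_comm, G.graph.adj_comm]

-- The mark makes the class of `u` a singleton. Along a path from `u`, double counting passes
-- equality of class sizes from each vertex to the next, the counts per vertex being the same in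
-- both graphs.
open Classical in
theorem count_pairColour_eq {u : G.V} {u' : H.V} (h : G.pairColour u u = H.pairColour u' u')
    (w : G.V) :
    ((Finset.univ : Finset G.V).val.map (G.pairColour u)).count (G.pairColour u w) =
      ((Finset.univ : Finset H.V).val.map (H.pairColour u')).count (G.pairColour u w) := by
  have hw := (SimpleGraph.reachable_iff_reflTransGen _ _).1 (G.connected.preconnected u w)
  induction hw with
  | refl =>
    have key (K : FinConnGraph) (r : K.V) :
        ((Finset.univ : Finset K.V).val.map (K.pairColour r)).count (K.pairColour r r) = 1 := by
      rw [Multiset.count_map, Multiset.card_eq_one]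
      refine ⟨r, ?_⟩
      have : (Finset.univ.filter fun x => K.pairColour r r = K.pairColour r x) = {r} := by
        ext x
        simp only [Finset.mem_filter, Finset.mem_univ, true_and, Finset.mem_singleton]
        exact ⟨fun e => ((eq_iff_of_pairColour_eq e).1 rfl).symm, fun e => by rw [e]⟩
      exact congrArg Finset.val this
    rw [key G u, h, key H u']
  | @tail w x _ hwx ih =>
    have hwx : G.graph.Adj w x := hwx
    have hG := count_mul_eq_count_mul (G := G) (G.pairColour u)
      (fun v hv => congrArg (Multiset.count (G.pairColour u x))
        (map_neighborFinset_pairColour_eq (v' := w) hv))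
      (fun v hv => congrArg (Multiset.count (G.pairColour u w))
        (map_neighborFinset_pairColour_eq (v' := x) hv))
    have hH := count_mul_eq_count_mul (G := H) (H.pairColour u')
      (fun v hv => congrArg (Multiset.count (G.pairColour u x))
        (map_neighborFinset_pairColour_eq (v' := w) hv))
      (fun v hv => congrArg (Multiset.count (G.pairColour u w))
        (map_neighborFinset_pairColour_eq (v' := x) hv))
    rw [ih, hH] at hG
    -- The factor to cancel is positive because `w` is itself a neighbour of `x`.
    refine (Nat.eq_of_mul_eq_mul_right (Multiset.count_pos.2 ?_) hG).symm
    exact Multiset.mem_map_of_mem _ ((G.graph.mem_neighborFinset x w).2 hwx.symm)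

/-- The colour of a marked vertex determines the colours of all vertices of its subgraph. -/
theorem map_univ_pairColour_eq {u : G.V} {u' : H.V} (h : G.pairColour u u = H.pairColour u' u') :
    (Finset.univ : Finset G.V).val.map (G.pairColour u) =
      (Finset.univ : Finset H.V).val.map (H.pairColour u') := by
  classical
  ext a
  by_cases hG : ∃ w, G.pairColour u w = a
  · obtain ⟨w, rfl⟩ := hG
    exact count_pairColour_eq h w
  by_cases hH : ∃ w, H.pairColour u' w = a
  · obtain ⟨w, rfl⟩ := hH
    exact (count_pairColour_eq h.symm w).symm
  rw [Multiset.count_eq_zero.2 (by simpa using hG), Multiset.count_eq_zero.2 (by simpa using hH)]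

/-- Graphs with the same PSWL(VS) representation have the same marked vertices. -/
theorem map_pairColour_diag_eq (h : PSWLVS.Same G H) :
    (Finset.univ : Finset G.V).val.map (fun u => G.pairColour u u) =
      (Finset.univ : Finset H.V).val.map (fun u => H.pairColour u u) := by
  obtain ⟨t, ht, hT⟩ := (h.and (eventually_pairColour_eq G H)).exists
  refine Multiset.map_eq_map_of_imp ht fun u _ u' _ hu => ?_
  have hmem : pswlColour G t u u ∈
      (Finset.univ : Finset H.V).val.map (fun v => pswlColour H t u' v) := by
    rw [← hu]
    exact Multiset.mem_map_of_mem _ (Finset.mem_univ u)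
  -- The marked colour occurs in the other pool, and the mark forces it onto the diagonal.
  obtain ⟨v', -, e⟩ := Multiset.mem_map.1 hmem
  have e' := hT u u u' v' e.symm
  obtain rfl := (eq_iff_of_pairColour_eq e').1 rfl
  exact e'

/-- The first step of a shortest walk to the root is copied to a neighbour of the same colour. -/
theorem spd_le_of_pairColour_eq {u : G.V} {u' : H.V} (n : ℕ) : ∀ {v : G.V} {v' : H.V},
    G.pairColour u v = H.pairColour u' v' → G.spd v u = n → H.spd v' u' ≤ n := by
  induction n with
  | zero =>
    intro v v' h hn
    obtain rfl := (G.connected.preconnected v u).dist_eq_zero_iff.1 hn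
    obtain rfl := (eq_iff_of_pairColour_eq h).1 rfl
    simp [spd]
  | succ n ih =>
    intro v v' h hn
    obtain ⟨p, hp⟩ := (G.connected.preconnected v u).exists_walk_length_eq_dist
    rw [show G.graph.dist v u = n + 1 from hn] at hp
    cases p with
    | nil => simp at hp
    | @cons _ w _ hvw p =>
      obtain ⟨w', hw', e⟩ := exists_adj_pairColour_eq h hvw
      have h1 : G.graph.dist w u ≤ n :=
        (SimpleGraph.dist_le p).trans (by simp at hp; omega)
      have h2 : n + 1 ≤ 1 + G.graph.dist w u := by
        rw [← show G.graph.dist v u = n + 1 from hn, ← SimpleGraph.dist_eq_one_iff_adj.2 hvw]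
        exact G.connected.dist_triangle
      have h3 : H.graph.dist w' u' ≤ n := ih e.symm (show G.graph.dist w u = n by omega)
      calc H.graph.dist v' u' ≤ H.graph.dist v' w' + H.graph.dist w' u' :=
            H.connected.dist_triangle
        _ ≤ n + 1 := by rw [SimpleGraph.dist_eq_one_iff_adj.2 hw']; omega

theorem spd_eq_of_pairColour_eq {u v : G.V} {u' v' : H.V}
    (h : G.pairColour u v = H.pairColour u' v') : G.spd v u = H.spd v' u' :=
  le_antisymm (spd_le_of_pairColour_eq _ h.symm rfl) (spd_le_of_pairColour_eq _ h rfl)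

end FinConnGraph

/-! ### First-visit probabilities and the comparison of the two algorithms -/

namespace FinConnGraph

variable {G H : FinConnGraph}

theorem firstHitProb_eq_sum_ite (u v : G.V) (d : ℕ) :
    G.firstHitProb u v d = ∑ p : Fin (d + 1) → G.V,
      if p 0 = u ∧ p (Fin.last d) = v ∧ ∀ i : Fin d, p i.castSucc ≠ v then G.walkProb p else 0 := by
  rw [firstHitProb, Finset.sum_filter]

theorem walkProb_cons {d : ℕ} (x : G.V) (q : Fin (d + 1) → G.V) :
    G.walkProb (Fin.cons x q : Fin (d + 2) → G.V) =
      (if G.graph.Adj x (q 0) then (G.graph.degree x : ℝ≥0∞)⁻¹ else 0) * G.walkProb q := by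
  rw [walkProb, Fin.prod_univ_succ]
  rfl

theorem firstHitProb_zero (u v : G.V) : G.firstHitProb u v 0 = if u = v then 1 else 0 := by
  rw [firstHitProb_eq_sum_ite, ← (Equiv.funUnique (Fin 1) G.V).symm.sum_comp]
  rw [Finset.sum_eq_single u]
  · simp [walkProb]
  · intro b _ hb
    simp [hb]
  · simp

theorem firstHitProb_self_succ (v : G.V) (d : ℕ) : G.firstHitProb v v (d + 1) = 0 := by
  rw [firstHitProb_eq_sum_ite]
  refine Finset.sum_eq_zero fun p _ => if_neg ?_
  rintro ⟨h0, -, h⟩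
  exact h 0 h0

theorem firstHitProb_succ {u v : G.V} (h : u ≠ v) (d : ℕ) :
    G.firstHitProb u v (d + 1) =
      (G.graph.degree u : ℝ≥0∞)⁻¹ * ∑ w ∈ G.graph.neighborFinset u, G.firstHitProb w v d := by
  have hcons : G.firstHitProb u v (d + 1) = ∑ q : Fin (d + 1) → G.V,
      if q (Fin.last d) = v ∧ ∀ i : Fin d, q i.castSucc ≠ v then
        (if G.graph.Adj u (q 0) then (G.graph.degree u : ℝ≥0∞)⁻¹ else 0) * G.walkProb q
      else 0 := by
    rw [firstHitProb_eq_sum_ite, ← (Fin.consEquiv fun _ => G.V).sum_comp, Fintype.sum_prod_type,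
      Finset.sum_eq_single u]
    · refine Finset.sum_congr rfl fun q _ => ?_
      refine if_congr ?_ (walkProb_cons u q) rfl
      rw [Fin.forall_fin_succ]
      change u = u ∧ q (Fin.last d) = v ∧ u ≠ v ∧ (∀ i : Fin d, q i.castSucc ≠ v) ↔ _
      simp [h]
    · intro x _ hx
      exact Finset.sum_eq_zero fun q _ => if_neg fun hq => hx hq.1
    · simp
  rw [hcons, Finset.mul_sum]
  simp only [firstHitProb_eq_sum_ite, Finset.mul_sum]
  rw [Finset.sum_comm]
  refine Finset.sum_congr rfl fun q _ => ?_
  by_cases hq : q (Fin.last d) = v ∧ ∀ i : Fin d, q i.castSucc ≠ v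
  · by_cases ha : G.graph.Adj u (q 0)
    · rw [Finset.sum_eq_single (q 0)]
      · simp [hq, ha]
      · intro w _ hw
        simp [hw.symm]
      · intro hn
        exact absurd ((G.graph.mem_neighborFinset u _).2 ha) hn
    · rw [Finset.sum_eq_zero]
      · simp [ha]
      · intro w hw
        rw [if_neg, mul_zero]
        rintro ⟨rfl, -⟩
        exact ha ((G.graph.mem_neighborFinset u _).1 hw)
  · rw [if_neg hq, Finset.sum_eq_zero]
    intro w _
    rw [if_neg fun h => hq h.2, mul_zero]

/-- The first-step recursion uses only the degree, the mark and the colours of the neighbours.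
Agreement for each `d` makes convergence irrelevant here. -/
theorem firstHitProb_eq_of_pairColour_eq {u : G.V} {u' : H.V} (d : ℕ) : ∀ {v : G.V} {v' : H.V},
    G.pairColour u v = H.pairColour u' v' → G.firstHitProb v u d = H.firstHitProb v' u' d := by
  induction d with
  | zero =>
    intro v v' h
    simp only [firstHitProb_zero, eq_comm (b := u), eq_comm (b := u'), eq_iff_of_pairColour_eq h]
  | succ d ih =>
    intro v v' h
    by_cases huv : u = v
    · obtain rfl := huv
      obtain rfl := (eq_iff_of_pairColour_eq h).1 rfl
      simp only [firstHitProb_self_succ]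
    · rw [firstHitProb_succ (Ne.symm huv),
        firstHitProb_succ (Ne.symm fun e => huv ((eq_iff_of_pairColour_eq h).2 e)),
        degree_eq_of_pairColour_eq h]
      exact congrArg (_ * Multiset.sum ·) (Multiset.map_eq_map_of_imp
        (map_neighborFinset_pairColour_eq h) fun w _ w' _ hw => ih hw)

theorem genDist_eq_of_pairColour_eq {u v : G.V} {u' v' : H.V}
    (h : G.pairColour u v = H.pairColour u' v') : genDist G v u = genDist H v' u' := by
  simp only [genDist, hittingTime, spd_eq_of_pairColour_eq h, firstHitProb_eq_of_pairColour_eq _ h]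

theorem gdColour_eq_of_pairColour_eq (t : ℕ) : ∀ {v : G.V} {v' : H.V},
    G.pairColour v v = H.pairColour v' v' → gdColour G t v = gdColour H t v' := by
  induction t with
  | zero => exact fun _ => rfl
  | succ t ih =>
    intro v v' h
    exact Multiset.map_eq_map_of_imp (map_univ_pairColour_eq h) fun u _ u' _ hu =>
      Prod.ext (genDist_eq_of_pairColour_eq hu) (ih (pairColour_diag_eq hu))

/-- PSWL(VS) is at least as powerful as GD-WL. -/
theorem gdwl_atMostAsPowerful_pswlvs : ColourRefinement.AtMostAsPowerful GDWL PSWLVS :=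
  fun _ _ h => Filter.Eventually.of_forall fun t => Multiset.map_eq_map_of_imp
    (map_pairColour_diag_eq h) fun _ _ _ _ hu => gdColour_eq_of_pairColour_eq t hu

/-! ### Hitting times as the unique solution of a linear system -/

/-- A function on the vertices that is harmonic away from `v` and vanishes at `v` is not positive
anywhere. -/
theorem nonpos_of_harmonic {v : G.V} {φ : G.V → ℝ} (hv : φ v = 0)
    (hφ : ∀ u, u ≠ v → (G.graph.degree u : ℝ) * φ u = ∑ w ∈ G.graph.neighborFinset u, φ w)
    (u : G.V) : φ u ≤ 0 := by
  have : Nonempty G.V := ⟨u⟩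
  obtain ⟨m, hm⟩ := Finite.exists_max φ
  suffices h : φ v = φ m by
    rw [← hv, h]
    exact hm u
  by_contra hne
  -- Maximum principle: away from `v` a maximal value is the average over the neighbours, so
  -- maximality spreads along paths and reaches `v`.
  have hmax (x : G.V) (hx : Relation.ReflTransGen G.graph.Adj m x) : φ x = φ m := by
    induction hx with
    | refl => rfl
    | @tail x y _ hxy ih =>
      have hxv : x ≠ v := fun e => hne (e ▸ ih)
      have hs : ∑ w ∈ G.graph.neighborFinset x, φ w = ∑ w ∈ G.graph.neighborFinset x, φ m := by
        rw [← hφ x hxv, ih, Finset.sum_const, nsmul_eq_mul,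
          SimpleGraph.card_neighborFinset_eq_degree]
      exact (Finset.sum_eq_sum_iff_of_le fun w _ => hm w).1 hs y
        ((G.graph.mem_neighborFinset x y).2 hxy)
  exact hne (hmax v ((SimpleGraph.reachable_iff_reflTransGen _ _).1
    (G.connected.preconnected m v)))

theorem eq_zero_of_harmonic {v : G.V} {φ : G.V → ℝ} (hv : φ v = 0)
    (hφ : ∀ u, u ≠ v → (G.graph.degree u : ℝ) * φ u = ∑ w ∈ G.graph.neighborFinset u, φ w)
    (u : G.V) : φ u = 0 := by
  refine le_antisymm (nonpos_of_harmonic hv hφ u) ?_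
  have := nonpos_of_harmonic (v := v) (φ := fun x => -φ x) (by simp [hv])
    (fun x hx => by simp [hφ x hx]) u
  linarith

theorem degree_ne_zero_of_ne {u v : G.V} (h : u ≠ v) : (G.graph.degree u : ℝ≥0∞) ≠ 0 := by
  have : Nontrivial G.V := ⟨u, v, h⟩
  exact Nat.cast_ne_zero.2 (G.connected.preconnected.degree_pos_of_nontrivial u).ne'

theorem sum_firstHitProb_le_one (v : G.V) (n : ℕ) (u : G.V) :
    ∑ d ∈ Finset.range n, G.firstHitProb u v d ≤ 1 := by
  induction n generalizing u with
  | zero => simp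
  | succ n ih =>
    rw [Finset.sum_range_succ', firstHitProb_zero]
    by_cases h : u = v
    · subst h
      simp [firstHitProb_self_succ]
    · simp only [firstHitProb_succ h, if_neg h, add_zero]
      rw [← Finset.mul_sum, Finset.sum_comm]
      calc _ ≤ (G.graph.degree u : ℝ≥0∞)⁻¹ * ∑ w ∈ G.graph.neighborFinset u, 1 := by
            gcongr with w _
            exact ih w
        _ = 1 := by
            rw [Finset.sum_const, nsmul_one, SimpleGraph.card_neighborFinset_eq_degree,
              ENNReal.inv_mul_cancel (degree_ne_zero_of_ne h) (ENNReal.natCast_ne_top _)]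

/-- The simple random walk on a finite connected graph visits every vertex almost surely. -/
theorem tsum_firstHitProb (u v : G.V) : ∑' d, G.firstHitProb u v d = 1 := by
  have hle (u : G.V) : ∑' d, G.firstHitProb u v d ≤ 1 :=
    ENNReal.tsum_le_of_sum_range_le fun n => sum_firstHitProb_le_one v n u
  have htop (u : G.V) : ∑' d, G.firstHitProb u v d ≠ ∞ := ((hle u).trans_lt ENNReal.one_lt_top).ne
  have hv : ∑' d, G.firstHitProb v v d = 1 := by
    rw [tsum_eq_zero_add' ENNReal.summable]
    simp [firstHitProb_zero, firstHitProb_self_succ]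
  have key := eq_zero_of_harmonic (G := G) (v := v)
    (φ := fun u => (∑' d, G.firstHitProb u v d).toReal - 1) (by simp [hv]) (fun u hu => by
      have h : (G.graph.degree u : ℝ≥0∞) * ∑' d, G.firstHitProb u v d =
          ∑ w ∈ G.graph.neighborFinset u, ∑' d, G.firstHitProb w v d := by
        rw [tsum_eq_zero_add' ENNReal.summable]
        simp only [firstHitProb_zero, if_neg hu, zero_add, firstHitProb_succ hu]
        rw [ENNReal.tsum_mul_left, ← mul_assoc, ENNReal.mul_inv_cancel (degree_ne_zero_of_ne hu)
          (ENNReal.natCast_ne_top _), one_mul, Summable.tsum_finsetSum fun _ _ => ENNReal.summable]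
      have h := congrArg ENNReal.toReal h
      rw [ENNReal.toReal_mul, ENNReal.toReal_natCast, ENNReal.toReal_sum fun w _ => htop w] at h
      rw [mul_sub, h, Finset.sum_sub_distrib]
      simp) u
  rw [← ENNReal.toReal_eq_one_iff]
  linarith

theorem hittingTime_self (v : G.V) : G.hittingTime v v = 0 := by
  rw [hittingTime, ENNReal.tsum_eq_zero]
  rintro (_ | d)
  · simp
  · simp [firstHitProb_self_succ]

/-- First step analysis of the hitting time. -/
theorem degree_mul_hittingTime {u v : G.V} (h : u ≠ v) :
    (G.graph.degree u : ℝ≥0∞) * G.hittingTime u v =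
      ∑ w ∈ G.graph.neighborFinset u, (G.hittingTime w v + 1) := by
  rw [hittingTime, tsum_eq_zero_add' ENNReal.summable]
  simp only [firstHitProb_succ h, Nat.cast_zero, zero_mul, zero_add]
  simp only [mul_left_comm _ (G.graph.degree u : ℝ≥0∞)⁻¹]
  rw [ENNReal.tsum_mul_left, ← mul_assoc, ENNReal.mul_inv_cancel (degree_ne_zero_of_ne h)
    (ENNReal.natCast_ne_top _), one_mul]
  simp only [Finset.mul_sum]
  rw [Summable.tsum_finsetSum fun _ _ => ENNReal.summable]
  refine Finset.sum_congr rfl fun w _ => ?_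
  -- The summand 1 is the total probability of ever reaching `v` from `w`.
  rw [hittingTime, ← tsum_firstHitProb w v, ← ENNReal.tsum_add]
  exact tsum_congr fun d => by push_cast; ring

/-- A finite supersolution bounds the hitting time, which makes the passage to real numbers
legitimate in `hittingTime_eq`. -/
theorem sum_mul_firstHitProb_le {v : G.V} {h : G.V → ℝ≥0∞}
    (hh : ∀ u, u ≠ v → ∑ w ∈ G.graph.neighborFinset u, (h w + 1) ≤ G.graph.degree u * h u)
    (n : ℕ) (u : G.V) :
    ∑ d ∈ Finset.range n, (d : ℝ≥0∞) * G.firstHitProb u v d ≤ h u := by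
  induction n generalizing u with
  | zero => simp
  | succ n ih =>
    rw [Finset.sum_range_succ']
    by_cases huv : u = v
    · subst huv
      simp [firstHitProb_self_succ]
    · simp only [firstHitProb_succ huv, Nat.cast_zero, zero_mul, add_zero,
        mul_left_comm _ (G.graph.degree u : ℝ≥0∞)⁻¹]
      rw [← Finset.mul_sum]
      simp only [Finset.mul_sum (s := G.graph.neighborFinset u)]
      rw [Finset.sum_comm]
      calc _ ≤ (G.graph.degree u : ℝ≥0∞)⁻¹ * ∑ w ∈ G.graph.neighborFinset u, (h w + 1) := by
            gcongr with w _
            calc _ = ∑ d ∈ Finset.range n, (d : ℝ≥0∞) * G.firstHitProb w v d +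
                  ∑ d ∈ Finset.range n, G.firstHitProb w v d := by
                  rw [← Finset.sum_add_distrib]
                  exact Finset.sum_congr rfl fun d _ => by push_cast; ring
              _ ≤ h w + 1 := add_le_add (ih w) (sum_firstHitProb_le_one v n w)
        _ ≤ (G.graph.degree u : ℝ≥0∞)⁻¹ * (G.graph.degree u * h u) := by
            gcongr
            exact hh u huv
        _ = h u := by
            rw [← mul_assoc, ENNReal.inv_mul_cancel (degree_ne_zero_of_ne huv)
              (ENNReal.natCast_ne_top _), one_mul]

/-- The hitting times of `v` are the only finite solution of the equations of first step
analysis. -/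
theorem hittingTime_eq {v : G.V} {h : G.V → ℝ≥0∞} (htop : ∀ u, h u ≠ ∞) (hv : h v = 0)
    (hh : ∀ u, u ≠ v → G.graph.degree u * h u = ∑ w ∈ G.graph.neighborFinset u, (h w + 1))
    (u : G.V) : G.hittingTime u v = h u := by
  have htop' (u : G.V) : G.hittingTime u v ≠ ∞ :=
    ((ENNReal.tsum_le_of_sum_range_le fun n =>
      sum_mul_firstHitProb_le (fun u hu => (hh u hu).ge) n u).trans_lt (htop u).lt_top).ne
  have toReal_eq {f : G.V → ℝ≥0∞} (hf : ∀ u, f u ≠ ∞) {u : G.V}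
      (h : (G.graph.degree u : ℝ≥0∞) * f u = ∑ w ∈ G.graph.neighborFinset u, (f w + 1)) :
      (G.graph.degree u : ℝ) * (f u).toReal =
        ∑ w ∈ G.graph.neighborFinset u, ((f w).toReal + 1) := by
    have h := congrArg ENNReal.toReal h
    rw [ENNReal.toReal_mul, ENNReal.toReal_natCast,
      ENNReal.toReal_sum fun w _ => ENNReal.add_ne_top.2 ⟨hf w, ENNReal.one_ne_top⟩] at h
    rw [h]
    exact Finset.sum_congr rfl fun w _ => by
      rw [ENNReal.toReal_add (hf w) ENNReal.one_ne_top, ENNReal.toReal_one]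
  -- The inhomogeneous terms cancel in the difference of two solutions.
  have key := eq_zero_of_harmonic (G := G) (v := v)
    (φ := fun u => (G.hittingTime u v).toReal - (h u).toReal) (by simp [hv, hittingTime_self])
    (fun u hu => by
      rw [mul_sub, toReal_eq htop' (degree_mul_hittingTime hu), toReal_eq htop (hh u hu),
        ← Finset.sum_sub_distrib]
      exact Finset.sum_congr rfl fun w _ => by ring) u
  exact (ENNReal.toReal_eq_toReal_iff' (htop' u) (htop u)).1 (by linarith)

end FinConnGraph

/-! ### Criteria for distances and for GD-WL colours -/

namespace FinConnGraph

/-- A function satisfying the recursive characterisation of the distance to `v`. -/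
theorem _root_.SimpleGraph.reachable_and_dist_eq {V : Type*} {A : SimpleGraph V} {v : V}
    {d : V → ℕ} (hv : d v = 0) (hlip : ∀ u w, A.Adj u w → d u ≤ d w + 1)
    (hdec : ∀ u, u ≠ v → ∃ w, A.Adj u w ∧ d u = d w + 1) (u : V) :
    A.Reachable u v ∧ A.dist u v = d u := by
  have hle (n : ℕ) : ∀ u, d u = n → ∃ p : A.Walk u v, p.length = n := by
    induction n with
    | zero =>
      intro u hu
      by_cases huv : u = v
      · subst huv
        exact ⟨.nil, rfl⟩
      · obtain ⟨w, -, hw⟩ := hdec u huv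
        omega
    | succ n ih =>
      intro u hu
      have huv : u ≠ v := by
        rintro rfl
        omega
      obtain ⟨w, hw, e⟩ := hdec u huv
      obtain ⟨p, hp⟩ := ih w (by omega)
      exact ⟨.cons hw p, by simp [hp]⟩
  have hge {u : V} (p : A.Walk u v) : d u ≤ p.length := by
    induction p with
    | nil => simp [hv]
    | cons h p ih =>
      have := hlip _ _ h
      have := ih hv hdec hle
      simp only [SimpleGraph.Walk.length_cons]
      omega
  obtain ⟨p, hp⟩ := hle _ u rfl
  obtain ⟨q, hq⟩ := p.reachable.exists_walk_length_eq_dist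
  exact ⟨p.reachable, le_antisymm (hp ▸ SimpleGraph.dist_le p) (hq ▸ hge q)⟩

/-- If the multiset of the distances and types of all vertices, seen from a vertex `v`, depends
only on the type of `v`, then GD-WL does not refine the types. -/
theorem gdColour_eq_of_type_eq {G H : FinConnGraph} {T : Type*} {f : G.V → T} {g : H.V → T}
    (hfg : ∀ v v', f v = g v' → (Finset.univ : Finset G.V).val.map (fun u => (genDist G u v, f u)) =
      (Finset.univ : Finset H.V).val.map fun u => (genDist H u v', g u)) (t : ℕ) :
    ∀ {v v'}, f v = g v' → gdColour G t v = gdColour H t v' := by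
  induction t with
  | zero => exact fun _ => rfl
  | succ t ih =>
    intro v v' h
    exact Multiset.map_eq_map_of_imp (hfg v v' h) fun u _ u' _ hu =>
      Prod.ext (Prod.mk.inj hu).1 (ih (Prod.mk.inj hu).2)

end FinConnGraph

/-! ### The separating pair of graphs -/

/-! Graphs on 21 vertices: the Kneser graph of the two-element subsets of a set of six points,
with a pendant vertex attached to each of the first six subsets. -/

namespace PendantKneser

/-- The edges of a hexagon, followed by the other pairs of its vertices. -/
def hexagon : List (ℕ × ℕ) :=
  [(0, 1), (1, 2), (2, 3), (3, 4), (4, 5), (0, 5),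
    (0, 2), (0, 3), (0, 4), (1, 3), (1, 4), (1, 5), (2, 4), (2, 5), (3, 5)]

/-- The edges of two disjoint triangles, followed by the other pairs of their vertices. -/
def triangles : List (ℕ × ℕ) :=
  [(0, 1), (1, 2), (0, 2), (3, 4), (4, 5), (3, 5),
    (0, 3), (0, 4), (0, 5), (1, 3), (1, 4), (1, 5), (2, 3), (2, 4), (2, 5)]

/-- The pair that a vertex is or is attached to. -/
def foot (L : List (ℕ × ℕ)) (u : Fin 21) : ℕ × ℕ :=
  L.getD (if u.val < 15 then u.val else u.val - 15) (0, 0)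

/-- Disjointness of the feet of two vertices. -/
def disj (L : List (ℕ × ℕ)) (u v : Fin 21) : Bool :=
  (foot L u).1 != (foot L v).1 && (foot L u).1 != (foot L v).2 &&
    (foot L u).2 != (foot L v).1 && (foot L u).2 != (foot L v).2

/-- Adjacency: disjoint pairs are adjacent, and so are a pendant vertex and its foot. -/
def adj (L : List (ℕ × ℕ)) (u v : Fin 21) : Bool :=
  if u.val < 15 then
    if v.val < 15 then disj L u v else foot L u == foot L v
  else decide (v.val < 15) && foot L u == foot L v

def nbrs (L : List (ℕ × ℕ)) (u : Fin 21) : Finset (Fin 21) :=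
  Finset.univ.filter fun w => adj L u w = true

/-- The distance. -/
def dst (L : List (ℕ × ℕ)) (u v : Fin 21) : ℕ :=
  if u = v then 0 else (if u.val < 15 then 0 else 1) + (if v.val < 15 then 0 else 1) +
    if foot L u = foot L v then 0 else if disj L u v then 1 else 2

/-- Pairs with a pendant vertex have type `0`, pairs without one `1`, pendant vertices `2`. -/
def type (u : Fin 21) : ℕ := if u.val < 6 then 0 else if u.val < 15 then 1 else 2

/-- Fifteen times the hitting time. -/
def hit (L : List (ℕ × ℕ)) (u v : Fin 21) : ℕ :=
  -- 238 and 272 are 15 · 51 · R, with 51 edges and effective resistance R = 14/45 between disjoint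
  -- pairs, 16/45 between meeting ones. The 6 accounts for the asymmetry between types. Leaving a
  -- pendant vertex takes 1 step, entering it from its foot 2 · 51 - 1 = 101. The subtraction never
  -- truncates: a vertex of type `1` shares its foot with no other vertex.
  if u = v then 0 else (if u.val < 15 then 0 else 15) + (if v.val < 15 then 0 else 1515) +
    (if foot L u = foot L v then 0 else if disj L u v then 238 else 272) +
    (if type v = 1 then 6 else 0) - (if type u = 1 then 6 else 0)

/-- The adjacency relation is that of a simple graph, and `dst` and `hit` satisfy the equations
that characterise the distance and the hitting time. -/
structure Good (L : List (ℕ × ℕ)) : Prop where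
  symm : ∀ u v, adj L u v = true → adj L v u = true
  irrefl : ∀ u, ¬ adj L u u = true
  dst_le : ∀ v u w, adj L u w = true → dst L u v ≤ dst L w v + 1
  exists_dst : ∀ v u, u ≠ v → ∃ w, adj L u w = true ∧ dst L u v = dst L w v + 1
  card_mul_hit : ∀ v u, u ≠ v → (nbrs L u).card * hit L u v =
    ∑ w ∈ nbrs L u, (hit L w v + 15)

theorem good_hexagon : Good hexagon where
  symm := by decide +kernel
  irrefl := by decide +kernel
  dst_le := by decide +kernel
  exists_dst := by decide +kernel
  card_mul_hit := by decide +kernel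

theorem good_triangles : Good triangles where
  symm := by decide +kernel
  irrefl := by decide +kernel
  dst_le := by decide +kernel
  exists_dst := by decide +kernel
  card_mul_hit := by decide +kernel

variable {L : List (ℕ × ℕ)}

def simpleGraph (hL : Good L) : SimpleGraph (Fin 21) where
  Adj u v := adj L u v = true
  symm := ⟨hL.symm⟩
  loopless := ⟨hL.irrefl⟩

instance (hL : Good L) : DecidableRel (simpleGraph hL).Adj :=
  fun u v => inferInstanceAs (Decidable (adj L u v = true))

theorem reachable_and_dist_eq (hL : Good L) (u v : Fin 21) :
    (simpleGraph hL).Reachable u v ∧ (simpleGraph hL).dist u v = dst L u v :=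
  SimpleGraph.reachable_and_dist_eq (d := fun u => dst L u v) (if_pos rfl)
    (hL.dst_le v) (hL.exists_dst v) u

def graph (hL : Good L) : FinConnGraph where
  V := Fin 21
  graph := simpleGraph hL
  connected := ⟨fun u v => (reachable_and_dist_eq hL u v).1⟩

theorem neighborFinset_eq (hL : Good L) (u : (graph hL).V) :
    (graph hL).graph.neighborFinset u = nbrs L u := by
  ext w
  rw [SimpleGraph.mem_neighborFinset]
  exact (Finset.mem_filter_univ w).symm

theorem degree_eq (hL : Good L) (u : (graph hL).V) :
    (graph hL).graph.degree u = (nbrs L u).card := by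
  rw [← SimpleGraph.card_neighborFinset_eq_degree, neighborFinset_eq]
  rfl

theorem hittingTime_eq (hL : Good L) (u v : Fin 21) :
    (graph hL).hittingTime u v = hit L u v / 15 := by
  have h15 : (15 : ℝ≥0∞) ≠ 0 := by norm_num
  refine FinConnGraph.hittingTime_eq (G := graph hL) (v := v)
    (h := fun u => (hit L u v : ℝ≥0∞) / 15) (fun u => ?_) ?_ (fun u hu => ?_) u
  · exact ENNReal.div_ne_top (ENNReal.natCast_ne_top _) h15
  · simp [hit]
  · have h := congrArg (Nat.cast (R := ℝ≥0∞)) (hL.card_mul_hit v u hu)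
    rw [neighborFinset_eq, degree_eq, ← mul_div_assoc, ← Nat.cast_mul, h, Nat.cast_sum,
      div_eq_mul_inv, Finset.sum_mul]
    refine Finset.sum_congr rfl fun w _ => ?_
    push_cast
    rw [add_mul, ENNReal.mul_inv_cancel h15 (by norm_num), div_eq_mul_inv]

theorem genDist_eq (hL : Good L) (u v : Fin 21) :
    genDist (graph hL) u v = (dst L u v, (hit L u v : ℝ≥0∞) / 15) :=
  Prod.ext (reachable_and_dist_eq hL u v).2 (hittingTime_eq hL u v)

/-- The distances, hitting times and types of all vertices, seen from a vertex. -/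
def view (L : List (ℕ × ℕ)) (v : Fin 21) : Multiset (ℕ × ℕ × ℕ) :=
  (Finset.univ : Finset (Fin 21)).val.map fun u => (dst L u v, hit L u v, type u)

theorem view_hexagon : ∀ v v', type v = type v' → view hexagon v = view triangles v' := by
  decide +kernel

theorem gdwl_same : GDWL.Same (graph good_hexagon) (graph good_triangles) := by
  have key := FinConnGraph.gdColour_eq_of_type_eq (G := graph good_hexagon)
    (H := graph good_triangles) (f := type) (g := type) fun v v' h =>
      Multiset.map_eq_map_of_imp (view_hexagon v v' h) fun u _ u' _ hu => by
        simp only [Prod.mk.injEq] at hu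
        refine Prod.ext ?_ hu.2.2
        rw [genDist_eq good_hexagon u v, genDist_eq good_triangles u' v', hu.1, hu.2.1]
  exact Filter.Eventually.of_forall fun t =>
    Multiset.map_eq_map_of_imp
      -- Both lists begin with F, so the type depends on the position alone.
      (rfl : (Finset.univ : Finset (Fin 21)).val.map type = Finset.univ.val.map type)
      fun _ _ _ _ h => key t h

theorem exists_triangle_hexagon : ∃ u v w, adj hexagon u v = true ∧ adj hexagon v w = true ∧
    adj hexagon w u = true ∧ (nbrs hexagon v).card = 7 ∧
    (nbrs hexagon w).card = 7 ∧
    (nbrs hexagon u).card = 7 :=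
  -- Alternate edges of the hexagon.
  ⟨0, 2, 4, by decide +kernel⟩

theorem not_exists_triangle_triangles : ¬ ∃ u v w, adj triangles u v = true ∧
    adj triangles v w = true ∧ adj triangles w u = true ∧
    (nbrs triangles v).card = 7 ∧
    (nbrs triangles w).card = 7 ∧
    (nbrs triangles u).card = 7 := by
  decide +kernel

theorem not_pswlvs_same : ¬ PSWLVS.Same (graph good_hexagon) (graph good_triangles) := by
  intro h
  obtain ⟨u, v, w, huv, hvw, hwu, hv, hw, hu⟩ := exists_triangle_hexagon
  have hmem := Multiset.mem_map_of_mem (fun u => (graph good_hexagon).pairColour u u)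
    (Finset.mem_univ_val (α := (graph good_hexagon).V) u)
  rw [FinConnGraph.map_pairColour_diag_eq h] at hmem
  obtain ⟨u', -, eu⟩ := Multiset.mem_map.1 hmem
  obtain ⟨v', huv', ev⟩ := FinConnGraph.exists_adj_pairColour_eq eu.symm (w := v) huv
  obtain ⟨w', hvw', ew⟩ := FinConnGraph.exists_adj_pairColour_eq ev.symm (w := w) hvw
  obtain ⟨x', hwx', ex⟩ := FinConnGraph.exists_adj_pairColour_eq ew.symm (w := u) hwu
  -- The mark shows that the copied walk returns to its start.
  obtain rfl := (FinConnGraph.eq_iff_of_pairColour_eq ex).2 rfl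
  have card {x x' : Fin 21} {y y' : Fin 21} (e : (graph good_triangles).pairColour x' y' =
      (graph good_hexagon).pairColour x y) (hy : (nbrs hexagon y).card = 7) :
      (nbrs triangles y').card = 7 :=
    (degree_eq good_triangles y').symm.trans
      ((FinConnGraph.degree_eq_of_pairColour_eq e).trans ((degree_eq good_hexagon y).trans hy))
  exact not_exists_triangle_triangles
    ⟨u', v', w', huv', hvw', hwx', card ev hv, card ew hw, card eu hu⟩

end PendantKneser

theorem theorem9p2 : ColourRefinement.StrictlyWeaker GDWL PSWLVS :=
  ⟨FinConnGraph.gdwl_atMostAsPowerful_pswlvs,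
    fun h => PendantKneser.not_pswlvs_same (h.2 _ _ PendantKneser.gdwl_same)⟩
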